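/- Let $a<0$, $I=(a,+\infty)$, and let $V\in C^4(I)$ satisfy $\lim_{u\to a^+}V(u)=h^*\in\mathbb{R}$, $\lim_{u\to a^+}V'(u)=-\infty$, $V(0)=V'(0)=0$, $V''(0)>0$ and $uV'(u)>0$ for all $u\in I\setminus\{0\}$ (so $h^*>0$). For $0<h<\sup_{u>0}V(u)$ let $u^+(h)$ be the unique $u>0$ with $V(u)=h$, and if moreover $h<h^*$ let $u^-(h)$ be the unique $u\in(a,0)$ with $V(u)=h$. Define the extended period function of $\ddot u+V'(u)=0$ by \[ T(h)=\begin{cases}\displaystyle\sqrt2\int_{u^-(h)}^{u^+(h)}\frac{du}{\sqrt{h-V(u)}} & \text{if } h<h^*,\\[2ex] \displaystyle\sqrt2\int_{a}^{u^+(h)}\frac{du}{\sqrt{h-V(u)}} & \text{if } h\ge h^*,\end{cases} \] that is, the period of the periodic orbit of energy $h$ if $h<h^*$, and the time between two consecutive collisions with the singularity $u=a$ of a bouncing solution of energy $h$ if $h\ge h^*$. Suppose that (a) $5V'''(u)^2-3V''(u)V^{(4)}(u)>0$ for all $u\in I$ with $V''(u)>0$; (b) $V'(u)V'''(u)<0$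 for all $u\in I$ with $V''(u)=0$. Then $T$ is differentiable with $T'(h)>0$ for every $h$ with $0<h<\sup_{u>0}V(u)$; in particular for every $h>0$ if $V(u)\to+\infty$ as $u\to+\infty$. -/

import Mathlib

open Set Filter Topology

/-- `V` is a potential on the half-line `(a, +∞)` with a weak singularity at `a` (finite limit
`hstar` of `V`, limit `-∞` of `V'`) and whose only critical point is a nondegenerate minimum
at `0`, with `V 0 = 0`. Only the values of `V` on `(a, +∞)` matter. -/
structure IsWeaklySingularPotential (a hstar : ℝ) (V : ℝ → ℝ) : Prop where
  left_neg : a < 0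
  contDiffOn : ContDiffOn ℝ 2 V (Ioi a)
  tendsto_left : Tendsto V (𝓝[>] a) (𝓝 hstar)
  tendsto_deriv_left : Tendsto (deriv V) (𝓝[>] a) atBot
  map_zero : V 0 = 0
  deriv_zero : deriv V 0 = 0
  deriv_two_zero : 0 < iteratedDeriv 2 V 0
  mul_deriv_pos : ∀ u, a < u → u ≠ 0 → 0 < u * deriv V u

/-- The positive solution `u⁺(h)` of `V u = h`
(unique when it exists, because `V` is strictly increasing on `[0, +∞)`). -/
noncomputable def uPlus (V : ℝ → ℝ) (h : ℝ) : ℝ :=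
  sInf {u : ℝ | 0 < u ∧ V u = h}

/-- The negative solution `u⁻(h)` of `V u = h` in `(a, 0)`
(unique when it exists, because `V` is strictly decreasing on `(a, 0]`). -/
noncomputable def uMinus (a : ℝ) (V : ℝ → ℝ) (h : ℝ) : ℝ :=
  sSup {u : ℝ | a < u ∧ u < 0 ∧ V u = h}

/-- The period `T_p(h)` of the periodic orbit of energy `h` of `u'' + V'(u) = 0`. -/
noncomputable def annulusPeriod (a : ℝ) (V : ℝ → ℝ) (h : ℝ) : ℝ :=
  √2 * ∫ u in (uMinus a V h)..(uPlus V h), 1 / √(h - V u)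

/-- The time `T_b(h)` between two consecutive collisions of a bouncing solution of energy `h`. -/
noncomputable def bouncingTime (a : ℝ) (V : ℝ → ℝ) (h : ℝ) : ℝ :=
  √2 * ∫ u in a..(uPlus V h), 1 / √(h - V u)

open Classical in
/-- The extended period function: `T_p(h)` if `h < hstar` and `T_b(h)` if `h ≥ hstar`. -/
noncomputable def extendedPeriod (a hstar : ℝ) (V : ℝ → ℝ) (h : ℝ) : ℝ :=
  if h < hstar then annulusPeriod a V h else bouncingTime a V h

/-!
Let `X` be the signed square root of the potential, `X ^ 2 = V` with `X` of the sign of `u`, and let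
`κ x = du / dx` be the derivative of its inverse. Substituting `X u = √h * sin θ` turns the period
into `√2 * ∫ κ (√h * sin θ) dθ` over `(-π / 2, π / 2)`. As `V' → -∞` at the singularity, `κ` tends
to `0` at the collision value `-√hstar`, and with `κ` extended by `0` below that value the same
formula gives the bouncing time (`extendedPeriod_eq`). Hence only two facts are needed: `κ` is
Lipschitz (`exists_lipschitzOnWith_profile`), which allows differentiation under the integral even
at `h = hstar`, and `κ' x > κ' 0` for `x > 0`, `κ' x < κ' 0` for `x < 0` (`mul_deriv_profile_pos`).
Since `sin` has integral `0`, the derivative in `√h` is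
`√2 * ∫ (κ' (√h * sin θ) - κ' 0) * sin θ dθ > 0`.

As a function of `u`, `κ'` is `bend = 2 * (V' ^ 2 - 2 * V * V'') / V' ^ 3`, and the derivative of
`bend` is `-2 * bendDefect / V' ^ 4`. Schaaf's first condition says that, where `V'' > 0`,
`bendDefect` is negative near `0` and can reach the value `0` on neither side, so that `bend`
increases. The second condition lets `V''` change sign only from `+` to `-` as `u` moves away from
`0`. To the left of `0` no such change happens, because `V'` is unbounded there. To the right,
beyond the inflection point `p`, one has `bend ≥ 2 / V' ≥ 2 / V' p = bend p` (`bend_zero_lt`).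
Finally `κ` is nonnegative, tends to `0` at the singularity and has increasing slope for `x < 0`,
so that `0 ≤ κ'` there and `κ' 0 > 0`: this bounds `κ'` near the singularity and gives
`κ' x = 0 < κ' 0` below the collision value.
-/

/-! ### Calculus on the real line -/

/-- A function that is nonpositive at the left endpoint and decreasing at each of its zeros stays
nonpositive. -/
theorem nonpos_of_deriv_neg_of_eq_zero {f f' : ℝ → ℝ} {p q : ℝ}
    (hf : ∀ x ∈ Icc p q, HasDerivAt f (f' x) x) (hp : f p ≤ 0)
    (h0 : ∀ x ∈ Icc p q, f x = 0 → f' x < 0) : ∀ x ∈ Icc p q, f x ≤ 0 := by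
  intro x hx
  exact image_le_of_deriv_right_lt_deriv_boundary' (f := f) (f' := f') (a := p) (b := q)
    (B := fun _ => 0) (B' := fun _ => 0)
    (fun y hy => (hf y hy).continuousAt.continuousWithinAt)
    (fun y hy => (hf y (Ico_subset_Icc_self hy)).hasDerivWithinAt) hp continuousOn_const
    (fun y _ => hasDerivWithinAt_const _ _ _)
    (fun y hy h => h0 y (Ico_subset_Icc_self hy) h) hx

/-- A function that is negative just to the right of the left endpoint and decreasing at each of
its zeros stays negative. -/
theorem neg_of_deriv_neg_of_eq_zero {f f' : ℝ → ℝ} {p q : ℝ}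
    (hf : ∀ x ∈ Ioc p q, HasDerivAt f (f' x) x) (hp : ∀ᶠ x in 𝓝[>] p, f x < 0)
    (h0 : ∀ x ∈ Ioc p q, f x = 0 → f' x < 0) : ∀ x ∈ Ioc p q, f x < 0 := by
  intro x hx
  obtain ⟨e, he, hpe⟩ := (hp.and (Ioo_mem_nhdsGT hx.1)).exists
  have hsub : Icc e x ⊆ Ioc p q := fun y hy => ⟨hpe.1.trans_le hy.1, hy.2.trans hx.2⟩
  have hle := nonpos_of_deriv_neg_of_eq_zero (fun y hy => hf y (hsub hy)) he.le
    (fun y hy => h0 y (hsub hy))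
  refine lt_of_le_of_ne (hle x ⟨hpe.2.le, le_rfl⟩) fun hfx => ?_
  -- at a first zero `x` the function would approach `0` from below, so its derivative is `≥ 0`
  have hd := hf x hx
  have ht := hd.tendsto_slope.mono_left
    (nhdsWithin_mono x (fun y hy => ne_of_lt hy : Iio x ⊆ {x}ᶜ))
  have : 0 ≤ f' x := by
    refine ge_of_tendsto ht ?_
    filter_upwards [Ioo_mem_nhdsLT hpe.2] with y hy
    rw [slope_def_field, hfx]
    exact div_nonneg_of_nonpos (by linarith [hle y ⟨hy.1.le, hy.2.le⟩]) (by linarith [hy.2])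
  exact absurd (h0 x hx hfx) (not_lt.2 this)

/-- A continuous function whose derivative, off the point `x`, is near `x` given by a function
continuous at `x` is differentiable at `x`. -/
theorem hasDerivAt_of_eventually_hasDerivAt_ne {f g : ℝ → ℝ} {x : ℝ}
    (hd : ∀ᶠ y in 𝓝[≠] x, HasDerivAt f (g y) y) (hf : ContinuousAt f x) (hg : ContinuousAt g x) :
    HasDerivAt f (g x) x := by
  have hg' : Tendsto (deriv f) (𝓝[≠] x) (𝓝 (g x)) :=
    (hg.tendsto.mono_left nhdsWithin_le_nhds).congr' (hd.mono fun y hy => hy.deriv.symm)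
  have hl : (𝓝[<] x) ≤ 𝓝[≠] x := nhdsWithin_mono x fun y hy => ne_of_lt hy
  have hr : (𝓝[>] x) ≤ 𝓝[≠] x := nhdsWithin_mono x fun y hy => ne_of_gt hy
  have A : HasDerivWithinAt f (g x) (Ici x) x :=
    hasDerivWithinAt_Ici_of_tendsto_deriv
      (s := {y | HasDerivAt f (g y) y})
      (fun y hy => hy.differentiableAt.differentiableWithinAt) hf.continuousWithinAt
      (hr hd) (hg'.mono_left hr)
  have B : HasDerivWithinAt f (g x) (Iic x) x :=
    hasDerivWithinAt_Iic_of_tendsto_deriv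
      (s := {y | HasDerivAt f (g y) y})
      (fun y hy => hy.differentiableAt.differentiableWithinAt) hf.continuousWithinAt
      (hl hd) (hg'.mono_left hl)
  simpa using B.union A

theorem strictMonoOn_of_hasDerivAt_pos {f f' : ℝ → ℝ} {D : Set ℝ} (hD : Convex ℝ D)
    (hc : ContinuousOn f D) (hd : ∀ x ∈ interior D, HasDerivAt f (f' x) x)
    (hpos : ∀ x ∈ interior D, 0 < f' x) : StrictMonoOn f D :=
  strictMonoOn_of_deriv_pos hD hc fun x hx => by rw [(hd x hx).deriv]; exact hpos x hx

theorem monotoneOn_of_hasDerivAt_nonneg {f f' : ℝ → ℝ} {D : Set ℝ} (hD : Convex ℝ D)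
    (hd : ∀ x ∈ D, HasDerivAt f (f' x) x) (hpos : ∀ x ∈ D, 0 ≤ f' x) : MonotoneOn f D :=
  monotoneOn_of_hasDerivWithinAt_nonneg hD
    (fun x hx => (hd x hx).continuousAt.continuousWithinAt)
    (fun x hx => (hd x (interior_subset hx)).hasDerivWithinAt)
    fun x hx => hpos x (interior_subset hx)

/-! ### The potential and its derivatives -/

/-- A weakly singular potential `V` with its derivatives `V₁, …, V₄` named, under Schaaf's two
conditions `schaaf` and `inflection`. -/
structure IsSchaafPotential (a hstar : ℝ) (V V₁ V₂ V₃ V₄ : ℝ → ℝ) : Prop where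
  left_neg : a < 0
  hasDerivAt : ∀ u, a < u → HasDerivAt V (V₁ u) u
  hasDerivAt₁ : ∀ u, a < u → HasDerivAt V₁ (V₂ u) u
  hasDerivAt₂ : ∀ u, a < u → HasDerivAt V₂ (V₃ u) u
  hasDerivAt₃ : ∀ u, a < u → HasDerivAt V₃ (V₄ u) u
  continuousAt₄ : ContinuousAt V₄ 0
  tendsto_left : Tendsto V (𝓝[>] a) (𝓝 hstar)
  tendsto_deriv_left : Tendsto V₁ (𝓝[>] a) atBot
  map_zero : V 0 = 0
  deriv_zero : V₁ 0 = 0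
  deriv_two_zero : 0 < V₂ 0
  mul_deriv_pos : ∀ u, a < u → u ≠ 0 → 0 < u * V₁ u
  schaaf : ∀ u, a < u → 0 < V₂ u → 0 < 5 * V₃ u ^ 2 - 3 * V₂ u * V₄ u
  inflection : ∀ u, a < u → V₂ u = 0 → V₁ u * V₃ u < 0

theorem hasDerivAt_iteratedDeriv_of_contDiffOn {f : ℝ → ℝ} {s : Set ℝ} (hs : IsOpen s) {n : ℕ}
    (hf : ContDiffOn ℝ n f s) {m : ℕ} (hm : m < n) {x : ℝ} (hx : x ∈ s) :
    HasDerivAt (iteratedDeriv m f) (iteratedDeriv (m + 1) f x) x := by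
  have h1 := hf.differentiableOn_iteratedDerivWithin (m := m) (by exact_mod_cast hm)
    hs.uniqueDiffOn
  have h2 : DifferentiableOn ℝ (iteratedDeriv m f) s :=
    h1.congr fun y hy => (iteratedDerivWithin_of_isOpen hs hy).symm
  rw [iteratedDeriv_succ]
  exact (h2.differentiableAt (hs.mem_nhds hx)).hasDerivAt

theorem IsWeaklySingularPotential.isSchaafPotential {a hstar : ℝ} {V : ℝ → ℝ}
    (hV : IsWeaklySingularPotential a hstar V) (hC4 : ContDiffOn ℝ 4 V (Ioi a))
    (hpos : ∀ u, a < u → 0 < iteratedDeriv 2 V u →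
      0 < 5 * (iteratedDeriv 3 V u) ^ 2 - 3 * iteratedDeriv 2 V u * iteratedDeriv 4 V u)
    (hzero : ∀ u, a < u → iteratedDeriv 2 V u = 0 → deriv V u * iteratedDeriv 3 V u < 0) :
    IsSchaafPotential a hstar V (deriv V) (iteratedDeriv 2 V) (iteratedDeriv 3 V)
      (iteratedDeriv 4 V) := by
  have key : ∀ m < 4, ∀ u, a < u →
      HasDerivAt (iteratedDeriv m V) (iteratedDeriv (m + 1) V u) u := fun m hm u hu =>
    hasDerivAt_iteratedDeriv_of_contDiffOn isOpen_Ioi (n := 4) (by exact_mod_cast hC4) hm hu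
  refine ⟨hV.left_neg, ?_, ?_, key 2 (by norm_num), key 3 (by norm_num), ?_, hV.tendsto_left,
    hV.tendsto_deriv_left, hV.map_zero, hV.deriv_zero, hV.deriv_two_zero, hV.mul_deriv_pos, hpos,
    hzero⟩
  · simpa using key 0 (by norm_num)
  · simpa using key 1 (by norm_num)
  · have h0 : Ioi a ∈ 𝓝 (0 : ℝ) := Ioi_mem_nhds hV.left_neg
    have h1 := hC4.continuousOn_iteratedDerivWithin (m := 4) (by norm_num) isOpen_Ioi.uniqueDiffOn
    exact (h1.congr fun y hy => (iteratedDerivWithin_of_isOpen isOpen_Ioi hy).symm).continuousAt h0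

/-- The ratio `V / V₁ ^ 2`, extended to `u = 0` by continuity. It is `K ^ 2 / 4` for the function `K`
of `stretch`, and needs no choice of sign for the square root of `V`. -/
noncomputable def potentialRatio (V V₁ V₂ : ℝ → ℝ) (u : ℝ) : ℝ :=
  if u = 0 then 1 / (2 * V₂ 0) else V u / V₁ u ^ 2

/-- The derivative `K = du / dX` of the inverse of the signed square root `X` of the potential,
as a function of `u`. -/
noncomputable def stretch (V V₁ V₂ : ℝ → ℝ) (u : ℝ) : ℝ := 2 * √(potentialRatio V V₁ V₂ u)

/-- The signed square root `X` of the potential, `X ^ 2 = V` with `X` of the sign of `u`. The formula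
solves `K = 2 * X / V₁` for `X`, so that `X` is differentiable at `0` because `K` is. -/
noncomputable def signedRoot (V V₁ V₂ : ℝ → ℝ) (u : ℝ) : ℝ := V₁ u * stretch V V₁ V₂ u / 2

/-- The second derivative `d²u / dX²` of the inverse of the signed square root `X` of the
potential, as a function of `u`; the value at `u = 0` is the limit. It equals twice the derivative
of `V / V₁ ^ 2`. -/
noncomputable def bend (V V₁ V₂ V₃ : ℝ → ℝ) (u : ℝ) : ℝ :=
  if u = 0 then -2 * V₃ 0 / (3 * V₂ 0 ^ 2) else 2 * (V₁ u ^ 2 - 2 * V u * V₂ u) / V₁ u ^ 3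

/-- Up to a negative factor, the derivative of `bend`. -/
noncomputable def bendDefect (V V₁ V₂ V₃ : ℝ → ℝ) (u : ℝ) : ℝ :=
  2 * V u * V₁ u * V₃ u + 3 * V₂ u * (V₁ u ^ 2 - 2 * V u * V₂ u)

open Classical in
/-- The derivative `du / dx` at `x` of the inverse `u(x)` of the signed square root `X` of the
potential, extended by `0` off the range of `X`. -/
noncomputable def profile (a : ℝ) (V V₁ V₂ : ℝ → ℝ) (x : ℝ) : ℝ :=
  if x ∈ signedRoot V V₁ V₂ '' Ioi a then
    stretch V V₁ V₂ (Function.invFunOn (signedRoot V V₁ V₂) (Ioi a) x)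
  else 0

/-- The time integral `∫ du / √(h - V u)` at energy `h = p ^ 2`, after the substitution
`X u = p * sin θ`. -/
noncomputable def angularTime (a : ℝ) (V V₁ V₂ : ℝ → ℝ) (p : ℝ) : ℝ :=
  ∫ θ in Ioo (-(Real.pi / 2)) (Real.pi / 2), profile a V V₁ V₂ (p * Real.sin θ)

namespace IsSchaafPotential

variable {a hstar : ℝ} {V V₁ V₂ V₃ V₄ : ℝ → ℝ}

theorem eventually_gt (h : IsSchaafPotential a hstar V V₁ V₂ V₃ V₄) : ∀ᶠ u in 𝓝[≠] (0 : ℝ), a < u :=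
  nhdsWithin_le_nhds (Ioi_mem_nhds h.left_neg)

theorem deriv_pos (h : IsSchaafPotential a hstar V V₁ V₂ V₃ V₄) {u : ℝ} (hu : 0 < u) : 0 < V₁ u :=
  pos_of_mul_pos_right (h.mul_deriv_pos u (h.left_neg.trans hu) hu.ne') hu.le

theorem deriv_neg (h : IsSchaafPotential a hstar V V₁ V₂ V₃ V₄) {u : ℝ} (hu : a < u) (hu0 : u < 0) :
    V₁ u < 0 := by
  have := h.mul_deriv_pos u hu hu0.ne
  nlinarith

theorem deriv_ne (h : IsSchaafPotential a hstar V V₁ V₂ V₃ V₄) {u : ℝ} (hu : a < u) (hu0 : u ≠ 0) :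
    V₁ u ≠ 0 := fun h0 => by
  have := h.mul_deriv_pos u hu hu0
  simp [h0] at this

theorem potential_pos (h : IsSchaafPotential a hstar V V₁ V₂ V₃ V₄) {u : ℝ} (hu : a < u)
    (hu0 : u ≠ 0) : 0 < V u := by
  have hc : ContinuousOn V (Ioi a) := fun y hy => (h.hasDerivAt y hy).continuousAt.continuousWithinAt
  rcases lt_or_gt_of_ne hu0 with hl | hr
  · have : StrictAntiOn V (Icc u 0) := by
      refine strictAntiOn_of_deriv_neg (convex_Icc u 0)
        (hc.mono fun y hy => hu.trans_le hy.1) fun y hy => ?_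
      rw [interior_Icc] at hy
      rw [(h.hasDerivAt y (hu.trans hy.1)).deriv]
      exact h.deriv_neg (hu.trans hy.1) hy.2
    simpa [h.map_zero] using this ⟨le_rfl, hl.le⟩ ⟨hl.le, le_rfl⟩ hl
  · have : StrictMonoOn V (Icc 0 u) := by
      refine strictMonoOn_of_deriv_pos (convex_Icc 0 u)
        (hc.mono fun y hy => h.left_neg.trans_le hy.1) fun y hy => ?_
      rw [interior_Icc] at hy
      rw [(h.hasDerivAt y (h.left_neg.trans hy.1)).deriv]
      exact h.deriv_pos hy.1
    simpa [h.map_zero] using this ⟨le_rfl, hr.le⟩ ⟨hr.le, le_rfl⟩ hr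

/-- To the right of the minimum the potential, once it is concave, remains so. -/
theorem deriv_two_nonpos_of_le (h : IsSchaafPotential a hstar V V₁ V₂ V₃ V₄) {p u : ℝ} (hp : 0 < p)
    (hV : V₂ p ≤ 0) (hu : p ≤ u) : V₂ u ≤ 0 := by
  refine nonpos_of_deriv_neg_of_eq_zero (f' := V₃) (p := p) (q := u)
    (fun x hx => h.hasDerivAt₂ x (h.left_neg.trans (hp.trans_le hx.1))) hV (fun x hx h0 => ?_) u
    ⟨hu, le_rfl⟩
  have h1 := h.inflection x (h.left_neg.trans (hp.trans_le hx.1)) h0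
  exact neg_of_mul_neg_right h1 (h.deriv_pos (hp.trans_le hx.1)).le

/-- The potential is convex to the left of its minimum: otherwise it would be concave from some
point down to `a`, and its derivative could not tend to `-∞` there. -/
theorem deriv_two_pos_of_neg (h : IsSchaafPotential a hstar V V₁ V₂ V₃ V₄) {u : ℝ} (hu : a < u)
    (hu0 : u < 0) : 0 < V₂ u := by
  by_contra! hV
  have hle : ∀ v, a < v → v ≤ u → V₂ v ≤ 0 := by
    intro v hv hvu
    have := nonpos_of_deriv_neg_of_eq_zero (f := fun x => V₂ (-x)) (f' := fun x => -V₃ (-x))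
      (p := -u) (q := -v) (fun x hx => ?_) (by simpa using hV) (fun x hx h0 => ?_) (-v)
      ⟨by linarith, le_rfl⟩
    · simpa using this
    · have := (h.hasDerivAt₂ (-x) (by linarith [hx.2])).comp x (hasDerivAt_neg x)
      simpa [Function.comp_def] using this
    · have h1 := h.inflection (-x) (by linarith [hx.2]) h0
      have h2 := h.deriv_neg (u := -x) (by linarith [hx.2]) (by linarith [hx.1])
      nlinarith
  have hanti : MonotoneOn (fun v => -V₁ v) (Ioc a u) :=
    monotoneOn_of_hasDerivAt_nonneg (convex_Ioc a u)
      (fun x hx => (h.hasDerivAt₁ x hx.1).neg) fun x hx => by linarith [hle x hx.1 hx.2]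
  obtain ⟨v, hv, hvu⟩ := ((h.tendsto_deriv_left.eventually_lt_atBot (V₁ u)).and
    (Ioo_mem_nhdsGT hu)).exists
  have := hanti ⟨hvu.1, hvu.2.le⟩ ⟨hu, le_rfl⟩ hvu.2.le
  simp only at this
  linarith

/-! ### Behaviour at the minimum -/

theorem tendsto_deriv_div (h : IsSchaafPotential a hstar V V₁ V₂ V₃ V₄) :
    Tendsto (fun u => V₁ u / u) (𝓝[≠] 0) (𝓝 (V₂ 0)) := by
  refine (h.hasDerivAt₁ 0 h.left_neg).tendsto_slope.congr fun u => ?_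
  rw [slope_def_field, h.deriv_zero, sub_zero, sub_zero]

theorem tendsto_potential_div (h : IsSchaafPotential a hstar V V₁ V₂ V₃ V₄) :
    Tendsto (fun u => V u / u ^ 2) (𝓝[≠] 0) (𝓝 (V₂ 0 / 2)) := by
  refine HasDerivAt.lhopital_zero_nhdsNE (f' := V₁) (g' := fun u => 2 * u)
    (h.eventually_gt.mono h.hasDerivAt) (Eventually.of_forall fun u => ?_)
    (eventually_mem_nhdsWithin.mono fun u hu => by simpa using hu) ?_ ?_ ?_
  · simpa using hasDerivAt_pow 2 u
  · simpa [h.map_zero] using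
      (h.hasDerivAt 0 h.left_neg).continuousAt.tendsto.mono_left nhdsWithin_le_nhds
  · simpa using ((continuous_pow 2).tendsto (0 : ℝ)).mono_left
      (nhdsWithin_le_nhds (s := ({0}ᶜ : Set ℝ)))
  · refine (h.tendsto_deriv_div.div_const 2).congr fun u => ?_
    rw [div_div, mul_comm]

theorem hasDerivAt_energyGap (h : IsSchaafPotential a hstar V V₁ V₂ V₃ V₄) {u : ℝ} (hu : a < u) :
    HasDerivAt (fun u => V₁ u ^ 2 - 2 * V u * V₂ u) (-2 * V u * V₃ u) u := by
  have := ((h.hasDerivAt₁ u hu).pow 2).sub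
    (((h.hasDerivAt u hu).const_mul 2).mul (h.hasDerivAt₂ u hu))
  refine this.congr_deriv ?_
  simp

theorem tendsto_energyGap_div (h : IsSchaafPotential a hstar V V₁ V₂ V₃ V₄) :
    Tendsto (fun u => (V₁ u ^ 2 - 2 * V u * V₂ u) / u ^ 3) (𝓝[≠] 0) (𝓝 (-(V₂ 0 * V₃ 0) / 3)) := by
  refine HasDerivAt.lhopital_zero_nhdsNE (f' := fun u => -2 * V u * V₃ u)
    (g' := fun u => 3 * u ^ 2)
    (h.eventually_gt.mono fun u => h.hasDerivAt_energyGap) (Eventually.of_forall fun u => ?_)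
    (eventually_mem_nhdsWithin.mono fun u hu => by simpa using hu) ?_ ?_ ?_
  · simpa using hasDerivAt_pow 3 u
  · simpa [h.map_zero, h.deriv_zero] using
      (h.hasDerivAt_energyGap h.left_neg).continuousAt.tendsto.mono_left
        (nhdsWithin_le_nhds (s := {0}ᶜ))
  · simpa using ((continuous_pow 3).tendsto (0 : ℝ)).mono_left
      (nhdsWithin_le_nhds (s := ({0}ᶜ : Set ℝ)))
  · have h3 : Tendsto V₃ (𝓝[≠] 0) (𝓝 (V₃ 0)) :=
      (h.hasDerivAt₃ 0 h.left_neg).continuousAt.tendsto.mono_left nhdsWithin_le_nhds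
    have := (h.tendsto_potential_div.mul h3).const_mul (-2 / 3)
    convert this using 2
    · ring
    · ring

theorem hasDerivAt_bendDefect (h : IsSchaafPotential a hstar V V₁ V₂ V₃ V₄) {u : ℝ} (hu : a < u) :
    HasDerivAt (bendDefect V V₁ V₂ V₃)
      (5 * V₃ u * (V₁ u ^ 2 - 2 * V u * V₂ u) + 2 * V u * V₁ u * V₄ u) u := by
  have := ((((h.hasDerivAt u hu).const_mul 2).mul (h.hasDerivAt₁ u hu)).mul
    (h.hasDerivAt₃ u hu)).add (((h.hasDerivAt₂ u hu).const_mul 3).mul (h.hasDerivAt_energyGap hu))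
  refine this.congr_deriv ?_
  simp; ring

theorem eventually_deriv_bendDefect_div_neg (h : IsSchaafPotential a hstar V V₁ V₂ V₃ V₄) :
    ∀ᶠ u in 𝓝[≠] (0 : ℝ),
      (5 * V₃ u * (V₁ u ^ 2 - 2 * V u * V₂ u) + 2 * V u * V₁ u * V₄ u) / u ^ 3 < 0 := by
  have h3 : Tendsto V₃ (𝓝[≠] 0) (𝓝 (V₃ 0)) :=
    (h.hasDerivAt₃ 0 h.left_neg).continuousAt.tendsto.mono_left nhdsWithin_le_nhds
  have h4 : Tendsto V₄ (𝓝[≠] 0) (𝓝 (V₄ 0)) :=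
    h.continuousAt₄.tendsto.mono_left nhdsWithin_le_nhds
  have ht := ((h3.mul h.tendsto_energyGap_div).const_mul 5).add
    (((h.tendsto_potential_div.mul h.tendsto_deriv_div).mul h4).const_mul 2)
  have hneg : 5 * (V₃ 0 * (-(V₂ 0 * V₃ 0) / 3)) + 2 * (V₂ 0 / 2 * V₂ 0 * V₄ 0) < 0 := by
    have := mul_pos h.deriv_two_zero (h.schaaf 0 h.left_neg h.deriv_two_zero)
    nlinarith
  filter_upwards [ht.eventually_lt_const hneg, self_mem_nhdsWithin] with u hu hu0
  have hu0 : u ≠ 0 := hu0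
  refine (le_of_eq ?_).trans_lt hu
  field_simp

theorem bendDefect_zero (h : IsSchaafPotential a hstar V V₁ V₂ V₃ V₄) :
    bendDefect V V₁ V₂ V₃ 0 = 0 := by
  simp [bendDefect, h.map_zero, h.deriv_zero]

theorem eventually_bendDefect_neg (h : IsSchaafPotential a hstar V V₁ V₂ V₃ V₄) :
    ∀ᶠ u in 𝓝[≠] (0 : ℝ), bendDefect V V₁ V₂ V₃ u < 0 := by
  have hev := h.eventually_deriv_bendDefect_div_neg
  rw [eventually_nhdsWithin_iff, Metric.eventually_nhds_iff] at hev
  obtain ⟨e, he, hev⟩ := hev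
  have hball : ∀ᶠ u in 𝓝[≠] (0 : ℝ), |u| < e := by
    refine nhdsWithin_le_nhds ?_
    simpa [Metric.ball, Real.dist_eq] using Metric.ball_mem_nhds (0 : ℝ) he
  have hc : ∀ u, a < u → ContinuousAt (bendDefect V V₁ V₂ V₃) u := fun u hu =>
    (h.hasDerivAt_bendDefect hu).continuousAt
  filter_upwards [hball, h.eventually_gt, self_mem_nhdsWithin] with u hue hau hu0
  rw [abs_lt] at hue
  rcases lt_or_gt_of_ne (show u ≠ 0 from hu0) with hl | hr
  · have : StrictMonoOn (bendDefect V V₁ V₂ V₃) (Icc u 0) := by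
      refine strictMonoOn_of_deriv_pos (convex_Icc u 0)
        (fun y hy => (hc y (hau.trans_le hy.1)).continuousWithinAt)
        (fun y hy => ?_)
      rw [interior_Icc] at hy
      rw [(h.hasDerivAt_bendDefect (hau.trans hy.1)).deriv]
      have := hev (y := y)
        (by rw [Real.dist_eq, sub_zero, abs_lt]; constructor <;> linarith [hy.1, hy.2]) hy.2.ne
      exact (div_neg_iff.1 this).elim And.left fun h' =>
        absurd h'.2 (not_lt.2 (Odd.pow_nonpos (by decide) hy.2.le))
    simpa [h.bendDefect_zero] using this ⟨le_rfl, hl.le⟩ ⟨hl.le, le_rfl⟩ hl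
  · have : StrictAntiOn (bendDefect V V₁ V₂ V₃) (Icc 0 u) := by
      refine strictAntiOn_of_deriv_neg (convex_Icc 0 u)
        (fun y hy => (hc y (h.left_neg.trans_le hy.1)).continuousWithinAt)
        (fun y hy => ?_)
      rw [interior_Icc] at hy
      rw [(h.hasDerivAt_bendDefect (h.left_neg.trans hy.1)).deriv]
      have := hev (y := y)
        (by rw [Real.dist_eq, sub_zero, abs_lt]; constructor <;> linarith [hy.1, hy.2]) hy.1.ne'
      exact (div_neg_iff.1 this).elim (fun h' => absurd h'.2 (not_lt.2 (pow_pos hy.1 3).le))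
        And.left
    simpa [h.bendDefect_zero] using this ⟨le_rfl, hr.le⟩ ⟨hr.le, le_rfl⟩ hr

/-- At a zero of `bendDefect` where the potential is convex, Schaaf's condition makes
`bendDefect` move towards negative values as `u` moves away from `0`. -/
theorem mul_deriv_bendDefect_neg (h : IsSchaafPotential a hstar V V₁ V₂ V₃ V₄) {u : ℝ} (hu : a < u)
    (hu0 : u ≠ 0) (h2 : 0 < V₂ u) (hM : bendDefect V V₁ V₂ V₃ u = 0) :
    V₁ u * (5 * V₃ u * (V₁ u ^ 2 - 2 * V u * V₂ u) + 2 * V u * V₁ u * V₄ u) < 0 := by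
  have hS := h.schaaf u hu h2
  have hV := h.potential_pos hu hu0
  have h1 : 0 < V₁ u ^ 2 := by have := h.deriv_ne hu hu0; positivity
  have hM' : 3 * V₂ u * (V₁ u ^ 2 - 2 * V u * V₂ u) = -(2 * V u * V₁ u * V₃ u) := by
    unfold bendDefect at hM; linarith
  have key : 3 * V₂ u * (V₁ u * (5 * V₃ u * (V₁ u ^ 2 - 2 * V u * V₂ u) + 2 * V u * V₁ u * V₄ u)) =
      -(2 * V u * V₁ u ^ 2 * (5 * V₃ u ^ 2 - 3 * V₂ u * V₄ u)) := by
    linear_combination 5 * V₁ u * V₃ u * hM'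
  have : 0 < 2 * V u * V₁ u ^ 2 * (5 * V₃ u ^ 2 - 3 * V₂ u * V₄ u) := by positivity
  have h3 : 0 < 3 * V₂ u := by positivity
  by_contra! hc
  have := mul_nonneg h3.le hc
  linarith

theorem bendDefect_neg_of_pos (h : IsSchaafPotential a hstar V V₁ V₂ V₃ V₄) {u : ℝ} (hu : 0 < u)
    (h2 : ∀ v ∈ Ioc 0 u, 0 < V₂ v) : bendDefect V V₁ V₂ V₃ u < 0 := by
  refine neg_of_deriv_neg_of_eq_zero
    (fun x hx => h.hasDerivAt_bendDefect (h.left_neg.trans hx.1))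
    (h.eventually_bendDefect_neg.filter_mono (nhdsWithin_mono 0 fun y hy => ne_of_gt hy))
    (fun x hx h0 => ?_) u ⟨hu, le_rfl⟩
  have := h.mul_deriv_bendDefect_neg (h.left_neg.trans hx.1) hx.1.ne' (h2 x hx) h0
  have := h.deriv_pos hx.1
  by_contra! hc
  nlinarith [mul_nonneg this.le hc]

theorem bendDefect_neg_of_neg (h : IsSchaafPotential a hstar V V₁ V₂ V₃ V₄) {u : ℝ} (hu : a < u)
    (hu0 : u < 0) : bendDefect V V₁ V₂ V₃ u < 0 := by
  have ht : Tendsto (fun x : ℝ => -x) (𝓝[>] 0) (𝓝[≠] 0) := by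
    refine tendsto_nhdsWithin_iff.2 ⟨?_, ?_⟩
    · simpa using (continuous_neg.tendsto (0 : ℝ)).mono_left nhdsWithin_le_nhds
    · filter_upwards [self_mem_nhdsWithin] with x hx
      exact neg_ne_zero.2 (ne_of_gt hx)
  have := neg_of_deriv_neg_of_eq_zero (f := fun x => bendDefect V V₁ V₂ V₃ (-x)) (p := 0) (q := -u)
    (fun x hx => (h.hasDerivAt_bendDefect (u := -x) (by linarith [hx.2])).comp x (hasDerivAt_neg x))
    (ht.eventually h.eventually_bendDefect_neg) (fun x hx h0 => ?_) (-u) ⟨by linarith, le_rfl⟩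
  · simpa using this
  · have hx1 : a < -x := by linarith [hx.2]
    have hx2 : -x < 0 := by linarith [hx.1]
    have h1 := h.mul_deriv_bendDefect_neg hx1 hx2.ne (h.deriv_two_pos_of_neg hx1 hx2) h0
    have h2 := h.deriv_neg hx1 hx2
    by_contra! hc
    rw [mul_neg_one] at hc
    exact absurd h1 (not_lt.2 (mul_nonneg_of_nonpos_of_nonpos h2.le (neg_nonneg.1 hc)))

/-! ### The signed square root of the potential and the derivatives of its inverse -/

local notation "K" => stretch V V₁ V₂
local notation "X" => signedRoot V V₁ V₂
local notation "P" => bend V V₁ V₂ V₃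
local notation "κ" => profile a V V₁ V₂

theorem continuousAt_bend_zero (h : IsSchaafPotential a hstar V V₁ V₂ V₃ V₄) : ContinuousAt P 0 := by
  rw [continuousAt_iff_punctured_nhds]
  have hb := h.deriv_two_zero.ne'
  have := (h.tendsto_energyGap_div.div (h.tendsto_deriv_div.pow 3) (by positivity)).const_mul 2
  have hlim : P 0 = 2 * (-(V₂ 0 * V₃ 0) / 3 / V₂ 0 ^ 3) := by
    simp only [bend, if_true]; field_simp
  rw [hlim]
  refine this.congr' ?_
  filter_upwards [self_mem_nhdsWithin, h.eventually_gt] with u hu hau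
  have hu : u ≠ 0 := hu
  have := h.deriv_ne hau hu
  simp only [bend, if_neg hu, Pi.div_apply]
  field_simp

theorem continuousAt_potentialRatio_zero (h : IsSchaafPotential a hstar V V₁ V₂ V₃ V₄) :
    ContinuousAt (potentialRatio V V₁ V₂) 0 := by
  rw [continuousAt_iff_punctured_nhds]
  have hb := h.deriv_two_zero.ne'
  have := h.tendsto_potential_div.div (h.tendsto_deriv_div.pow 2) (by positivity)
  have hlim : potentialRatio V V₁ V₂ 0 = V₂ 0 / 2 / V₂ 0 ^ 2 := by
    simp only [potentialRatio, if_true]; field_simp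
  rw [hlim]
  refine this.congr' ?_
  filter_upwards [self_mem_nhdsWithin, h.eventually_gt] with u hu hau
  have hu : u ≠ 0 := hu
  have := h.deriv_ne hau hu
  simp only [potentialRatio, if_neg hu, Pi.div_apply]
  field_simp

theorem hasDerivAt_bend (h : IsSchaafPotential a hstar V V₁ V₂ V₃ V₄) {u : ℝ} (hu : a < u)
    (hu0 : u ≠ 0) : HasDerivAt P (-2 * bendDefect V V₁ V₂ V₃ u / V₁ u ^ 4) u := by
  have h1 := h.deriv_ne hu hu0
  have hd := ((h.hasDerivAt_energyGap hu).const_mul 2).div ((h.hasDerivAt₁ u hu).pow 3)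
    (pow_ne_zero 3 h1)
  refine (hd.congr_of_eventuallyEq ?_).congr_deriv ?_
  · filter_upwards [isOpen_ne.mem_nhds hu0] with v hv
    simp [bend, if_neg (show v ≠ 0 from hv)]
  · simp only [bendDefect, Pi.pow_apply]
    field_simp
    push_cast
    ring

theorem hasDerivAt_potentialRatio (h : IsSchaafPotential a hstar V V₁ V₂ V₃ V₄) {u : ℝ}
    (hu : a < u) : HasDerivAt (potentialRatio V V₁ V₂) (P u / 2) u := by
  have hne : ∀ v, a < v → v ≠ 0 → HasDerivAt (potentialRatio V V₁ V₂) (P v / 2) v := by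
    intro v hv hv0
    have h1 := h.deriv_ne hv hv0
    have hd := (h.hasDerivAt v hv).div ((h.hasDerivAt₁ v hv).pow 2) (pow_ne_zero 2 h1)
    refine (hd.congr_of_eventuallyEq ?_).congr_deriv ?_
    · filter_upwards [isOpen_ne.mem_nhds hv0] with w hw
      simp [potentialRatio, if_neg (show w ≠ 0 from hw)]
    · simp only [bend, if_neg hv0, Pi.pow_apply]
      field_simp
      push_cast
      ring
  rcases eq_or_ne u 0 with rfl | hu0
  · refine hasDerivAt_of_eventually_hasDerivAt_ne (g := fun v => P v / 2) ?_
      h.continuousAt_potentialRatio_zero (h.continuousAt_bend_zero.div_const 2)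
    filter_upwards [self_mem_nhdsWithin, h.eventually_gt] with v hv hav using hne v hav hv
  · exact hne u hu hu0

theorem potentialRatio_pos (h : IsSchaafPotential a hstar V V₁ V₂ V₃ V₄) {u : ℝ} (hu : a < u) :
    0 < potentialRatio V V₁ V₂ u := by
  unfold potentialRatio
  split_ifs with h0
  · have := h.deriv_two_zero
    positivity
  · have := h.deriv_ne hu h0
    have := h.potential_pos hu h0
    positivity

theorem stretch_pos (h : IsSchaafPotential a hstar V V₁ V₂ V₃ V₄) {u : ℝ} (hu : a < u) : 0 < K u :=
  mul_pos two_pos (Real.sqrt_pos.2 (h.potentialRatio_pos hu))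

theorem stretch_sq (h : IsSchaafPotential a hstar V V₁ V₂ V₃ V₄) {u : ℝ} (hu : a < u) :
    K u ^ 2 = 4 * potentialRatio V V₁ V₂ u := by
  rw [stretch, mul_pow, Real.sq_sqrt (h.potentialRatio_pos hu).le]; norm_num

theorem hasDerivAt_stretch (h : IsSchaafPotential a hstar V V₁ V₂ V₃ V₄) {u : ℝ} (hu : a < u) :
    HasDerivAt K (P u / K u) u := by
  refine (((h.hasDerivAt_potentialRatio hu).sqrt
    (h.potentialRatio_pos hu).ne').const_mul 2).congr_deriv ?_
  unfold stretch
  ring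

theorem hasDerivAt_signedRoot (h : IsSchaafPotential a hstar V V₁ V₂ V₃ V₄) {u : ℝ} (hu : a < u) :
    HasDerivAt X (1 / K u) u := by
  refine (((h.hasDerivAt₁ u hu).mul (h.hasDerivAt_stretch hu)).div_const 2).congr_deriv ?_
  have hK := h.stretch_pos hu
  have hsq := h.stretch_sq hu
  field_simp
  rw [hsq]
  rcases eq_or_ne u 0 with rfl | hu0
  · have := h.deriv_two_zero.ne'
    simp only [potentialRatio, h.deriv_zero, if_true]
    field_simp
    norm_num
  · have := h.deriv_ne hu hu0
    simp only [potentialRatio, bend, if_neg hu0]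
    field_simp
    ring

theorem signedRoot_sq (h : IsSchaafPotential a hstar V V₁ V₂ V₃ V₄) {u : ℝ} (hu : a < u) :
    X u ^ 2 = V u := by
  rw [signedRoot, div_pow, mul_pow, h.stretch_sq hu]
  rcases eq_or_ne u 0 with rfl | hu0
  · simp [h.map_zero, h.deriv_zero]
  · have := h.deriv_ne hu hu0
    simp only [potentialRatio, if_neg hu0]
    field_simp
    ring

theorem signedRoot_zero (h : IsSchaafPotential a hstar V V₁ V₂ V₃ V₄) : X 0 = 0 := by
  simp [signedRoot, h.deriv_zero]

theorem strictMonoOn_signedRoot (h : IsSchaafPotential a hstar V V₁ V₂ V₃ V₄) :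
    StrictMonoOn X (Ioi a) := by
  refine strictMonoOn_of_hasDerivAt_pos (f' := fun u => 1 / K u) (convex_Ioi a)
    (fun u hu => (h.hasDerivAt_signedRoot hu).continuousAt.continuousWithinAt) ?_ ?_ <;>
    rw [interior_Ioi] <;> intro u hu
  · exact h.hasDerivAt_signedRoot hu
  · exact one_div_pos.2 (h.stretch_pos hu)

theorem continuousOn_signedRoot (h : IsSchaafPotential a hstar V V₁ V₂ V₃ V₄) :
    ContinuousOn X (Ioi a) :=
  fun _ hu => (h.hasDerivAt_signedRoot hu).continuousAt.continuousWithinAt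

theorem tendsto_signedRoot_left (h : IsSchaafPotential a hstar V V₁ V₂ V₃ V₄) :
    Tendsto X (𝓝[>] a) (𝓝 (-√hstar)) := by
  refine (h.tendsto_left.sqrt.neg).congr' ?_
  filter_upwards [Ioo_mem_nhdsGT h.left_neg] with u hu
  have hX : X u ≤ 0 := by
    simpa [h.signedRoot_zero] using
      (h.strictMonoOn_signedRoot.monotoneOn hu.1 (show (0 : ℝ) ∈ Ioi a from h.left_neg) hu.2.le)
  rw [← h.signedRoot_sq hu.1, Real.sqrt_sq_eq_abs, abs_of_nonpos hX, neg_neg]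

theorem lt_signedRoot (h : IsSchaafPotential a hstar V V₁ V₂ V₃ V₄) {u : ℝ} (hu : a < u) :
    -√hstar < X u := by
  obtain ⟨v, hv, hvu⟩ := exists_between hu
  refine lt_of_le_of_lt ?_ (h.strictMonoOn_signedRoot hv hu hvu)
  refine le_of_tendsto h.tendsto_signedRoot_left ?_
  filter_upwards [Ioo_mem_nhdsGT hv] with w hw using
    h.strictMonoOn_signedRoot.monotoneOn hw.1 hv hw.2.le

/-- The signed square root maps `(a, v]` onto `(-√hstar, X v]`. -/
theorem mem_image_signedRoot (h : IsSchaafPotential a hstar V V₁ V₂ V₃ V₄) {v x : ℝ} (hv : a < v)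
    (hx : -√hstar < x) (hxv : x ≤ X v) : ∃ u, a < u ∧ u ≤ v ∧ X u = x := by
  obtain ⟨w, hw, hwv⟩ := ((h.tendsto_signedRoot_left.eventually_lt_const hx).and
    (Ioo_mem_nhdsGT hv)).exists
  obtain ⟨u, hu, hux⟩ := intermediate_value_Icc hwv.2.le
    (h.continuousOn_signedRoot.mono fun y hy => hwv.1.trans_le hy.1) ⟨hw.le, hxv⟩
  exact ⟨u, hwv.1.trans_le hu.1, hu.2, hux⟩

theorem tendsto_stretch_left (h : IsSchaafPotential a hstar V V₁ V₂ V₃ V₄) :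
    Tendsto K (𝓝[>] a) (𝓝 0) := by
  refine ((h.tendsto_signedRoot_left.const_mul 2).div_atBot h.tendsto_deriv_left).congr' ?_
  filter_upwards [Ioo_mem_nhdsGT h.left_neg] with u hu
  have := h.deriv_ne hu.1 hu.2.ne
  rw [signedRoot]
  field_simp

/-! ### The sign of `d²u / dX²` relative to its value at the minimum -/

theorem bend_lt_of_convex (h : IsSchaafPotential a hstar V V₁ V₂ V₃ V₄) {u : ℝ} (hu : 0 < u)
    (h2 : ∀ v ∈ Ioo 0 u, 0 < V₂ v) : P 0 < P u := by
  have hmono : StrictMonoOn P (Icc 0 u) := by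
    refine strictMonoOn_of_hasDerivAt_pos
      (f' := fun u => -2 * bendDefect V V₁ V₂ V₃ u / V₁ u ^ 4) (convex_Icc 0 u)
      (fun y hy => ?_) ?_ ?_
    · rcases eq_or_ne y 0 with rfl | hy0
      · exact h.continuousAt_bend_zero.continuousWithinAt
      · exact (h.hasDerivAt_bend (h.left_neg.trans_le hy.1) hy0).continuousAt.continuousWithinAt
    all_goals rw [interior_Icc]; intro y hy
    · exact h.hasDerivAt_bend (h.left_neg.trans hy.1) hy.1.ne'
    · have h1 := h.deriv_pos hy.1
      have h3 := h.bendDefect_neg_of_pos hy.1 fun v hv => h2 v ⟨hv.1, hv.2.trans_lt hy.2⟩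
      exact div_pos (by linarith) (by positivity)
  exact hmono ⟨le_rfl, hu.le⟩ ⟨hu.le, le_rfl⟩ hu

/-- Where the potential is convex, `bend` increases. Beyond the first inflection point `p`, it is at
least `2 / V₁`, which is at least its value `2 / V₁ p` at `p`. -/
theorem bend_zero_lt (h : IsSchaafPotential a hstar V V₁ V₂ V₃ V₄) {u : ℝ} (hu : 0 < u) :
    P 0 < P u := by
  by_cases hconv : ∀ v ∈ Ioo 0 u, 0 < V₂ v
  · exact h.bend_lt_of_convex hu hconv
  push Not at hconv
  obtain ⟨w, hw, hw2⟩ := hconv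
  have hc : ContinuousOn V₂ (Icc 0 u) := fun y hy =>
    (h.hasDerivAt₂ y (h.left_neg.trans_le hy.1)).continuousAt.continuousWithinAt
  have hcomp : IsCompact (Icc 0 u ∩ V₂ ⁻¹' Iic 0) :=
    isCompact_Icc.of_isClosed_subset (hc.preimage_isClosed_of_isClosed isClosed_Icc isClosed_Iic)
      inter_subset_left
  obtain ⟨p, ⟨hp, hp2⟩, hleast⟩ := hcomp.exists_isLeast ⟨w, ⟨hw.1.le, hw.2.le⟩, hw2⟩
  have hp2 : V₂ p ≤ 0 := hp2
  have hp0 : 0 < p := lt_of_le_of_ne hp.1 fun h0 => by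
    rw [← h0] at hp2; exact absurd h.deriv_two_zero (not_lt.2 hp2)
  have hbefore : ∀ v ∈ Ioo 0 p, 0 < V₂ v := fun v hv => by
    by_contra! hv2
    exact absurd (hleast ⟨⟨hv.1.le, hv.2.le.trans hp.2⟩, hv2⟩) (not_le.2 hv.2)
  have hp2' : V₂ p = 0 := by
    refine le_antisymm hp2 (ge_of_tendsto
      ((h.hasDerivAt₂ p (h.left_neg.trans hp0)).continuousAt.tendsto.mono_left
        (nhdsWithin_le_nhds (s := Iio p))) ?_)
    filter_upwards [Ioo_mem_nhdsLT hp0] with v hv using (hbefore v hv).le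
  refine (h.bend_lt_of_convex hp0 hbefore).trans_le ?_
  have hmono : MonotoneOn (fun v => -V₁ v) (Icc p u) :=
    monotoneOn_of_hasDerivAt_nonneg (convex_Icc p u)
      (fun y hy => (h.hasDerivAt₁ y (h.left_neg.trans (hp0.trans_le hy.1))).neg)
      fun y hy => neg_nonneg.2 (h.deriv_two_nonpos_of_le hp0 hp2 hy.1)
  have hle : V₁ u ≤ V₁ p := neg_le_neg_iff.1 (hmono ⟨le_rfl, hp.2⟩ ⟨hp.2, le_rfl⟩ hp.2)
  have h1u := h.deriv_pos hu
  have h1p := h.deriv_pos hp0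
  have hVu := h.potential_pos (h.left_neg.trans hu) hu.ne'
  have h2u := h.deriv_two_nonpos_of_le hp0 hp2 hp.2
  calc P p = 2 / V₁ p := by
        simp only [bend, if_neg hp0.ne', hp2']; field_simp; ring
    _ ≤ 2 / V₁ u := div_le_div_of_nonneg_left zero_le_two h1u hle
    _ = 2 * V₁ u ^ 2 / V₁ u ^ 3 := by field_simp
    _ ≤ P u := by
        simp only [bend, if_neg hu.ne']
        gcongr
        nlinarith [mul_nonneg hVu.le (neg_nonneg.2 h2u)]

theorem strictMonoOn_bend_left (h : IsSchaafPotential a hstar V V₁ V₂ V₃ V₄) :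
    StrictMonoOn P (Ioc a 0) := by
  refine strictMonoOn_of_hasDerivAt_pos
    (f' := fun u => -2 * bendDefect V V₁ V₂ V₃ u / V₁ u ^ 4) (convex_Ioc a 0)
    (fun y hy => ?_) ?_ ?_
  · rcases eq_or_ne y 0 with rfl | hy0
    · exact h.continuousAt_bend_zero.continuousWithinAt
    · exact (h.hasDerivAt_bend hy.1 hy0).continuousAt.continuousWithinAt
  all_goals rw [interior_Ioc]; intro y hy
  · exact h.hasDerivAt_bend hy.1 hy.2.ne
  · have h1 := h.deriv_ne hy.1 hy.2.ne
    have h3 := h.bendDefect_neg_of_neg hy.1 hy.2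
    exact div_pos (by linarith) (by positivity)

/-- If `bend` were negative at `u < 0`, the positive function `K` would be decreasing on `(a, u]`,
although it tends to `0` at `a`. -/
theorem bend_nonneg_of_neg (h : IsSchaafPotential a hstar V V₁ V₂ V₃ V₄) {u : ℝ} (hu : a < u)
    (hu0 : u < 0) : 0 ≤ P u := by
  by_contra! hneg
  have hmono : MonotoneOn (fun v => -K v) (Ioc a u) := by
    refine monotoneOn_of_hasDerivAt_nonneg (convex_Ioc a u)
      (fun y hy => (h.hasDerivAt_stretch hy.1).neg) fun y hy => ?_
    have := h.strictMonoOn_bend_left.monotoneOn ⟨hy.1, hy.2.trans hu0.le⟩ ⟨hu, hu0.le⟩ hy.2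
    exact neg_nonneg.2 (div_nonpos_of_nonpos_of_nonneg (this.trans hneg.le)
      (h.stretch_pos hy.1).le)
  have : K u ≤ 0 := by
    refine ge_of_tendsto h.tendsto_stretch_left ?_
    filter_upwards [Ioo_mem_nhdsGT hu] with v hv using
      neg_le_neg_iff.1 (hmono ⟨hv.1, hv.2.le⟩ ⟨hu, le_rfl⟩ hv.2.le)
  exact absurd (h.stretch_pos hu) (not_lt.2 this)

theorem bend_lt_bend_zero (h : IsSchaafPotential a hstar V V₁ V₂ V₃ V₄) {u : ℝ} (hu : a < u)
    (hu0 : u < 0) : P u < P 0 :=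
  h.strictMonoOn_bend_left ⟨hu, hu0.le⟩ ⟨h.left_neg, le_rfl⟩ hu0

theorem bend_zero_pos (h : IsSchaafPotential a hstar V V₁ V₂ V₃ V₄) : 0 < P 0 := by
  obtain ⟨u, hu, hu0⟩ := exists_between h.left_neg
  exact (h.bend_nonneg_of_neg hu hu0).trans_lt (h.bend_lt_bend_zero hu hu0)

theorem exists_abs_bend_le (h : IsSchaafPotential a hstar V V₁ V₂ V₃ V₄) (v : ℝ) :
    ∃ C, ∀ u, a < u → u ≤ v → |P u| ≤ C := by
  have hc : ContinuousOn P (Icc 0 v) := fun y hy => by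
    rcases eq_or_ne y 0 with rfl | hy0
    · exact h.continuousAt_bend_zero.continuousWithinAt
    · exact (h.hasDerivAt_bend (h.left_neg.trans_le hy.1) hy0).continuousAt.continuousWithinAt
  obtain ⟨C, hC⟩ := isCompact_Icc.exists_bound_of_continuousOn hc
  refine ⟨max C (P 0), fun u hu huv => ?_⟩
  rcases lt_or_ge u 0 with hu0 | hu0
  · rw [abs_of_nonneg (h.bend_nonneg_of_neg hu hu0)]
    exact (h.bend_lt_bend_zero hu hu0).le.trans (le_max_right _ _)
  · exact (hC u ⟨hu0, huv⟩).trans (le_max_left _ _)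

/-! ### The integrand after the change of variables -/

theorem profile_signedRoot (h : IsSchaafPotential a hstar V V₁ V₂ V₃ V₄) {u : ℝ} (hu : a < u) :
    κ (X u) = K u := by
  rw [profile, if_pos ⟨u, hu, rfl⟩, h.strictMonoOn_signedRoot.injOn.leftInvOn_invFunOn hu]

theorem profile_of_le (h : IsSchaafPotential a hstar V V₁ V₂ V₃ V₄) {x : ℝ} (hx : x ≤ -√hstar) :
    κ x = 0 := by
  rw [profile, if_neg]
  rintro ⟨u, hu, rfl⟩
  exact absurd (h.lt_signedRoot hu) (not_lt.2 hx)

theorem image_signedRoot_mem_nhds (h : IsSchaafPotential a hstar V V₁ V₂ V₃ V₄) {u : ℝ}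
    (hu : a < u) : X '' Ioi a ∈ 𝓝 (X u) := by
  have hu1 : a < u + 1 := hu.trans (lt_add_one u)
  filter_upwards [Ioo_mem_nhds (h.lt_signedRoot hu)
    (h.strictMonoOn_signedRoot hu hu1 (lt_add_one u))] with x hx
  obtain ⟨w, hw, -, hwx⟩ := h.mem_image_signedRoot hu1 hx.1 hx.2.le
  exact ⟨w, hw, hwx⟩

theorem hasDerivAt_profile (h : IsSchaafPotential a hstar V V₁ V₂ V₃ V₄) {u : ℝ} (hu : a < u) :
    HasDerivAt κ (P u) (X u) := by
  set k := Function.invFunOn X (Ioi a) with hk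
  have hX := h.strictMonoOn_signedRoot
  have hleft : ∀ w, a < w → k (X w) = w := fun w hw => hX.injOn.leftInvOn_invFunOn hw
  have hmem := h.image_signedRoot_mem_nhds hu
  have hkmono : StrictMonoOn k (X '' Ioi a) := by
    rintro _ ⟨v, hv, rfl⟩ _ ⟨w, hw, rfl⟩ hvw
    rw [hleft v hv, hleft w hw]
    exact (hX.lt_iff_lt hv hw).1 hvw
  have hkc : ContinuousAt k (X u) := by
    refine hkmono.continuousAt_of_image_mem_nhds hmem ?_
    rw [hleft u hu]
    filter_upwards [Ioi_mem_nhds hu] with w hw using ⟨X w, ⟨w, hw, rfl⟩, hleft w hw⟩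
  have hK := h.stretch_pos hu
  have hkd : HasDerivAt k (K u) (X u) := by
    have := HasDerivAt.of_local_left_inverse (f := X) (f' := 1 / K u) hkc
      (by rw [hleft u hu]; exact h.hasDerivAt_signedRoot hu) (one_div_pos.2 hK).ne'
      (by
        filter_upwards [hmem] with x hx
        obtain ⟨w, hw, rfl⟩ := hx
        rw [hleft w hw])
    simpa using this
  have hKd : HasDerivAt K (P u / K u) (k (X u)) := by
    rw [hleft u hu]; exact h.hasDerivAt_stretch hu
  refine ((hKd.comp (X u) hkd).congr_of_eventuallyEq ?_).congr_deriv (by field_simp)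
  filter_upwards [hmem] with x hx
  rw [profile, if_pos hx, Function.comp_apply]

theorem stretch_sub_le (h : IsSchaafPotential a hstar V V₁ V₂ V₃ V₄) {v C : ℝ}
    (hC : ∀ u, a < u → u ≤ v → |P u| ≤ C) {u w : ℝ} (hu : a < u) (huw : u ≤ w) (hw : w ≤ v) :
    |K w - K u| ≤ C * (X w - X u) := by
  have h1 : MonotoneOn (fun y => C * X y - K y) (Ioc a v) := by
    refine monotoneOn_of_hasDerivAt_nonneg (convex_Ioc a v) (fun y hy =>
      ((h.hasDerivAt_signedRoot hy.1).const_mul C).sub (h.hasDerivAt_stretch hy.1)) fun y hy => ?_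
    have := h.stretch_pos hy.1
    rw [mul_one_div, ← sub_div]
    exact div_nonneg (by linarith [(abs_le.1 (hC y hy.1 hy.2)).2]) this.le
  have h2 : MonotoneOn (fun y => C * X y + K y) (Ioc a v) := by
    refine monotoneOn_of_hasDerivAt_nonneg (convex_Ioc a v) (fun y hy =>
      ((h.hasDerivAt_signedRoot hy.1).const_mul C).add (h.hasDerivAt_stretch hy.1)) fun y hy => ?_
    have := h.stretch_pos hy.1
    rw [mul_one_div, ← add_div]
    exact div_nonneg (by linarith [(abs_le.1 (hC y hy.1 hy.2)).1]) this.le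
  have e1 := h1 ⟨hu, huw.trans hw⟩ ⟨hu.trans_le huw, hw⟩ huw
  have e2 := h2 ⟨hu, huw.trans hw⟩ ⟨hu.trans_le huw, hw⟩ huw
  simp only at e1 e2
  rw [abs_le]
  constructor <;> linarith

theorem stretch_le (h : IsSchaafPotential a hstar V V₁ V₂ V₃ V₄) {v C : ℝ}
    (hC : ∀ u, a < u → u ≤ v → |P u| ≤ C) {w : ℝ} (haw : a < w) (hw : w ≤ v) :
    K w ≤ C * (X w + √hstar) := by
  have ht : Tendsto (fun u => C * (X w - X u) + K u) (𝓝[>] a) (𝓝 (C * (X w - -√hstar) + 0)) :=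
    ((h.tendsto_signedRoot_left.const_sub (X w)).const_mul C).add h.tendsto_stretch_left
  rw [sub_neg_eq_add, add_zero] at ht
  refine ge_of_tendsto ht ?_
  filter_upwards [Ioo_mem_nhdsGT haw] with u hu
  linarith [(abs_le.1 (h.stretch_sub_le hC hu.1 hu.2.le hw)).2]

/-- The extension by zero across the collision value `-√hstar` is Lipschitz, because `K` tends
to `0` at the singularity. -/
theorem exists_lipschitzOnWith_profile (h : IsSchaafPotential a hstar V V₁ V₂ V₃ V₄) {v : ℝ}
    (hv : a < v) : ∃ C, LipschitzOnWith C κ (Iic (X v)) := by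
  obtain ⟨C, hC⟩ := h.exists_abs_bend_le v
  have hC0 : 0 ≤ C := (abs_nonneg _).trans (hC v hv le_rfl)
  have key : ∀ x y, x ≤ y → y ≤ X v → |κ y - κ x| ≤ C * (y - x) := by
    intro x y hxy hy
    rcases le_or_gt y (-√hstar) with hy' | hy'
    · rw [h.profile_of_le hy', h.profile_of_le (hxy.trans hy'), sub_zero, abs_zero]
      exact mul_nonneg hC0 (sub_nonneg.2 hxy)
    obtain ⟨w, hw, hwv, rfl⟩ := h.mem_image_signedRoot hv hy' hy
    rcases le_or_gt x (-√hstar) with hx' | hx'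
    · rw [h.profile_of_le hx', sub_zero, h.profile_signedRoot hw, abs_of_pos (h.stretch_pos hw)]
      exact (h.stretch_le hC hw hwv).trans (mul_le_mul_of_nonneg_left (by linarith) hC0)
    obtain ⟨u, hu, huv, rfl⟩ := h.mem_image_signedRoot hv hx' (hxy.trans hy)
    rw [h.profile_signedRoot hw, h.profile_signedRoot hu]
    exact h.stretch_sub_le hC hu ((h.strictMonoOn_signedRoot.le_iff_le hu hw).1 hxy) hwv
  refine ⟨C.toNNReal, LipschitzOnWith.of_dist_le_mul fun x hx y hy => ?_⟩
  rw [Real.coe_toNNReal C hC0, Real.dist_eq, Real.dist_eq]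
  rcases le_total x y with hxy | hxy
  · rw [abs_sub_comm, abs_sub_comm x, abs_of_nonneg (sub_nonneg.2 hxy)]
    exact key x y hxy hy
  · rw [abs_of_nonneg (sub_nonneg.2 hxy)]
    exact key y x hxy hx

theorem hasDerivAt_profile_of_ne (h : IsSchaafPotential a hstar V V₁ V₂ V₃ V₄) {v x : ℝ}
    (hv : a < v) (hx : x ≠ -√hstar) (hxv : x ≤ X v) : HasDerivAt κ (deriv κ x) x := by
  rcases lt_or_gt_of_ne hx with hl | hr
  · have : κ =ᶠ[𝓝 x] fun _ => 0 := by
      filter_upwards [Iio_mem_nhds hl] with y hy using h.profile_of_le (le_of_lt hy)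
    exact ((hasDerivAt_const x (0 : ℝ)).congr_of_eventuallyEq this).differentiableAt.hasDerivAt
  · obtain ⟨u, hu, -, rfl⟩ := h.mem_image_signedRoot hv hr hxv
    exact (h.hasDerivAt_profile hu).differentiableAt.hasDerivAt

/-- The slope of the profile lies above its value at `0` for `x > 0`, and below it for `x < 0`,
also beyond the collision value, where the slope is `0`. -/
theorem mul_deriv_profile_pos (h : IsSchaafPotential a hstar V V₁ V₂ V₃ V₄) {v x : ℝ} (hv : a < v)
    (hx : x ≠ -√hstar) (hx0 : x ≠ 0) (hxv : x ≤ X v) : 0 < (deriv κ x - P 0) * x := by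
  have h0 : (0 : ℝ) ∈ Ioi a := h.left_neg
  rcases lt_or_gt_of_ne hx with hl | hr
  · have : κ =ᶠ[𝓝 x] fun _ => 0 := by
      filter_upwards [Iio_mem_nhds hl] with y hy using h.profile_of_le (le_of_lt hy)
    rw [this.deriv_eq, deriv_const, zero_sub]
    exact mul_pos_of_neg_of_neg (neg_neg_of_pos h.bend_zero_pos)
      (hl.trans_le (neg_nonpos.2 (Real.sqrt_nonneg _)))
  · obtain ⟨u, hu, -, rfl⟩ := h.mem_image_signedRoot hv hr hxv
    rw [(h.hasDerivAt_profile hu).deriv]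
    rcases lt_trichotomy u 0 with hneg | rfl | hpos
    · have := h.strictMonoOn_signedRoot hu h0 hneg
      rw [h.signedRoot_zero] at this
      exact mul_pos_of_neg_of_neg (sub_neg.2 (h.bend_lt_bend_zero hu hneg)) this
    · exact absurd h.signedRoot_zero hx0
    · have := h.strictMonoOn_signedRoot h0 hu hpos
      rw [h.signedRoot_zero] at this
      exact mul_pos (sub_pos.2 (h.bend_zero_lt hpos)) this

/-! ### The derivative of the time integral -/

theorem ae_mul_sin_ne {p : ℝ} (hp : 0 < p) (y : ℝ) :
    ∀ᵐ θ ∂MeasureTheory.volume.restrict (Ioo (-(Real.pi / 2)) (Real.pi / 2)),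
      p * Real.sin θ ≠ y := by
  refine (MeasureTheory.ae_restrict_iff' measurableSet_Ioo).2 ?_
  filter_upwards [MeasureTheory.compl_mem_ae_iff.2
    (MeasureTheory.measure_singleton (Real.arcsin (y / p)))] with θ hθ hmem heq
  refine hθ ?_
  rw [mem_singleton_iff, ← heq, mul_div_cancel_left₀ _ hp.ne', Real.arcsin_sin hmem.1.le hmem.2.le]

theorem mul_sin_le {p : ℝ} (hp : 0 < p) (θ : ℝ) : p * Real.sin θ ≤ p :=
  mul_le_of_le_one_right hp.le (Real.sin_le_one θ)

theorem hasDerivAt_angularTime (h : IsSchaafPotential a hstar V V₁ V₂ V₃ V₄) {v p : ℝ} (hv : a < v)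
    (hp : 0 < p) (hpv : p < X v) :
    MeasureTheory.IntegrableOn (fun θ => deriv κ (p * Real.sin θ) * Real.sin θ)
        (Ioo (-(Real.pi / 2)) (Real.pi / 2)) ∧
      HasDerivAt (angularTime a V V₁ V₂)
        (∫ θ in Ioo (-(Real.pi / 2)) (Real.pi / 2), deriv κ (p * Real.sin θ) * Real.sin θ) p := by
  obtain ⟨C, hC⟩ := h.exists_lipschitzOnWith_profile hv
  have hcont : ∀ q, 0 < q → q < X v → Continuous fun θ => κ (q * Real.sin θ) := fun q hq hqv =>
    hC.continuousOn.comp_continuous (by fun_prop) fun θ => (mul_sin_le hq θ).trans hqv.le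
  refine hasDerivAt_integral_of_dominated_loc_of_lip (s := Ioo 0 (X v)) (bound := fun _ => (C : ℝ))
    (F := fun p θ => κ (p * Real.sin θ)) (Ioo_mem_nhds hp hpv) ?_ ?_ ?_ ?_ ?_ ?_
  · filter_upwards [Ioo_mem_nhds hp hpv] with q hq
    exact (hcont q hq.1 hq.2).aestronglyMeasurable
  · exact ((hcont p hp hpv).integrableOn_Icc).mono_set Ioo_subset_Icc_self
  · exact (((measurable_deriv κ).comp (by fun_prop)).mul
      Real.measurable_sin).aestronglyMeasurable
  · refine Eventually.of_forall fun θ => LipschitzOnWith.of_dist_le_mul fun q hq r hr => ?_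
    have hb := hC.dist_le_mul (q * Real.sin θ) ((mul_sin_le hq.1 θ).trans hq.2.le)
      (r * Real.sin θ) ((mul_sin_le hr.1 θ).trans hr.2.le)
    simp only [Real.coe_nnabs, NNReal.abs_eq, Real.dist_eq, ← sub_mul, abs_mul] at hb ⊢
    exact hb.trans (mul_le_mul_of_nonneg_left
      (mul_le_of_le_one_right (abs_nonneg _) (Real.abs_sin_le_one θ)) C.2)
  · exact MeasureTheory.integrable_const _
  · filter_upwards [ae_mul_sin_ne hp (-√hstar)] with θ hθ
    have hd := h.hasDerivAt_profile_of_ne hv hθ ((mul_sin_le hp θ).trans hpv.le)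
    have := hd.comp p ((hasDerivAt_id p).mul_const (Real.sin θ))
    simpa [Function.comp_def] using this

/-- Since `sin` has integral `0`, the slope of the profile may be replaced by its excess over the
value at `0`, which has the sign of `sin`. -/
theorem deriv_angularTime_pos (h : IsSchaafPotential a hstar V V₁ V₂ V₃ V₄) {v p : ℝ} (hv : a < v)
    (hp : 0 < p) (hpv : p < X v) : 0 <
      ∫ θ in Ioo (-(Real.pi / 2)) (Real.pi / 2), deriv κ (p * Real.sin θ) * Real.sin θ := by
  have hint := (h.hasDerivAt_angularTime hv hp hpv).1
  have hsin : MeasureTheory.IntegrableOn (fun θ => P 0 * Real.sin θ)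
      (Ioo (-(Real.pi / 2)) (Real.pi / 2)) :=
    ((Real.continuous_sin.const_mul (P 0)).integrableOn_Icc).mono_set Ioo_subset_Icc_self
  have hzero : ∫ θ in Ioo (-(Real.pi / 2)) (Real.pi / 2), P 0 * Real.sin θ = 0 := by
    rw [← MeasureTheory.integral_Ioc_eq_integral_Ioo, ← intervalIntegral.integral_of_le
      (by linarith [Real.pi_pos])]
    simp
  have heq := MeasureTheory.integral_sub hint hsin
  rw [hzero, sub_zero] at heq
  rw [← heq]
  have hpos : ∀ᵐ θ ∂MeasureTheory.volume.restrict (Ioo (-(Real.pi / 2)) (Real.pi / 2)),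
      0 < deriv κ (p * Real.sin θ) * Real.sin θ - P 0 * Real.sin θ := by
    filter_upwards [ae_mul_sin_ne hp (-√hstar), ae_mul_sin_ne hp 0] with θ h1 h2
    have := h.mul_deriv_profile_pos hv h1 h2 ((mul_sin_le hp θ).trans hpv.le)
    refine pos_of_mul_pos_right (a := p) ?_ hp.le
    linarith
  have hnonneg := hpos.mono fun θ hθ => hθ.le
  refine lt_of_le_of_ne (MeasureTheory.integral_nonneg_of_ae hnonneg) fun h0 => ?_
  have hae := (MeasureTheory.integral_eq_zero_iff_of_nonneg_ae hnonneg (hint.sub hsin)).1 h0.symm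
  have hfalse : ∀ᵐ θ ∂MeasureTheory.volume.restrict (Ioo (-(Real.pi / 2)) (Real.pi / 2)),
      False := by
    filter_upwards [hpos, hae] with θ h1 h2
    exact h1.ne' h2
  rw [MeasureTheory.ae_iff] at hfalse
  have hpi := Real.pi_pos
  simp at hfalse
  linarith

/-! ### The extended period as a time integral -/

/-- The substitution `X u = √e * sin θ`. Outside the range of `X` the profile vanishes, so that the
integral extends over the whole interval of angles, also for orbits that hit the singularity. -/
theorem setIntegral_eq_angularTime (h : IsSchaafPotential a hstar V V₁ V₂ V₃ V₄) {e : ℝ}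
    (he : 0 < e) : ∫ u in {u | a < u ∧ V u < e}, 1 / √(e - V u) = angularTime a V V₁ V₂ √e := by
  set s := {u | a < u ∧ V u < e} with hs
  set f : ℝ → ℝ := fun u => Real.arcsin (X u / √e) with hf
  have hr : 0 < √e := Real.sqrt_pos.2 he
  have hlt : ∀ u ∈ s, -1 < X u / √e ∧ X u / √e < 1 := by
    intro u hu
    rw [← abs_lt, ← sq_lt_one_iff_abs_lt_one, div_pow, h.signedRoot_sq hu.1, Real.sq_sqrt he.le,
      div_lt_one he]
    exact hu.2
  have hsin : ∀ u ∈ s, √e * Real.sin (f u) = X u := by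
    intro u hu
    rw [hf, Real.sin_arcsin (hlt u hu).1.le (hlt u hu).2.le, mul_div_cancel₀ _ hr.ne']
  have hopen : IsOpen s := by
    have hc : ContinuousOn V (Ioi a) := fun y hy =>
      (h.hasDerivAt y hy).continuousAt.continuousWithinAt
    exact hc.isOpen_inter_preimage isOpen_Ioi isOpen_Iio
  have hderiv : ∀ u ∈ s, HasDerivAt f (1 / √(1 - (X u / √e) ^ 2) * (1 / K u / √e)) u := by
    intro u hu
    exact (Real.hasDerivAt_arcsin (hlt u hu).1.ne' (hlt u hu).2.ne).comp u
      ((h.hasDerivAt_signedRoot hu.1).div_const _)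
  have hinj : InjOn f s := fun u hu w hw huw => by
    refine h.strictMonoOn_signedRoot.injOn hu.1 hw.1 ?_
    rw [← hsin u hu, ← hsin w hw, huw]
  have hsub : f '' s ⊆ Ioo (-(Real.pi / 2)) (Real.pi / 2) := by
    rintro _ ⟨u, hu, rfl⟩
    exact ⟨Real.neg_pi_div_two_lt_arcsin.2 (hlt u hu).1, Real.arcsin_lt_pi_div_two.2 (hlt u hu).2⟩
  have hout : ∀ θ ∈ Ioo (-(Real.pi / 2)) (Real.pi / 2) \ f '' s, κ (√e * Real.sin θ) = 0 := by
    rintro θ ⟨hθ, hnot⟩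
    rw [profile, if_neg]
    rintro ⟨u, hu, hux⟩
    have hcos : 0 < Real.cos θ := Real.cos_pos_of_mem_Ioo hθ
    refine hnot ⟨u, ⟨hu, ?_⟩, ?_⟩
    · rw [← h.signedRoot_sq hu, hux, mul_pow, Real.sq_sqrt he.le, Real.sin_sq]
      nlinarith [mul_pos he (pow_pos hcos 2)]
    · rw [hf]
      simp only [hux]
      rw [mul_div_cancel_left₀ _ hr.ne', Real.arcsin_sin hθ.1.le hθ.2.le]
  rw [angularTime, MeasureTheory.setIntegral_eq_of_subset_of_forall_sdiff_eq_zero measurableSet_Ioo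
    hsub hout, MeasureTheory.integral_image_eq_integral_abs_deriv_smul hopen.measurableSet
    (fun u hu => (hderiv u hu).hasDerivWithinAt) hinj]
  refine MeasureTheory.setIntegral_congr_fun hopen.measurableSet fun u hu => ?_
  have hK := h.stretch_pos hu.1
  have hgap : 0 < e - V u := sub_pos.2 hu.2
  have hsqrt : √(1 - (X u / √e) ^ 2) = √(e - V u) / √e := by
    rw [div_pow, h.signedRoot_sq hu.1, Real.sq_sqrt he.le, ← Real.sqrt_div hgap.le, sub_div,
      div_self he.ne']
  have hg := Real.sqrt_pos.2 hgap
  simp only [smul_eq_mul]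
  rw [hsin u hu, h.profile_signedRoot hu.1, hsqrt, abs_of_pos (by positivity)]
  field_simp

theorem signedRoot_eq_sqrt (h : IsSchaafPotential a hstar V V₁ V₂ V₃ V₄) {u : ℝ} (hu : 0 < u) :
    X u = √(V u) := by
  have h0 := h.strictMonoOn_signedRoot h.left_neg (h.left_neg.trans hu) hu
  rw [h.signedRoot_zero] at h0
  rw [← h.signedRoot_sq (h.left_neg.trans hu), Real.sqrt_sq h0.le]

theorem signedRoot_eq_neg_sqrt (h : IsSchaafPotential a hstar V V₁ V₂ V₃ V₄) {u : ℝ} (hu : a < u)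
    (hu0 : u < 0) : X u = -√(V u) := by
  have h0 := h.strictMonoOn_signedRoot hu h.left_neg hu0
  rw [h.signedRoot_zero] at h0
  rw [← h.signedRoot_sq hu, Real.sqrt_sq_eq_abs, abs_of_neg h0, neg_neg]

theorem uPlus_eq (h : IsSchaafPotential a hstar V V₁ V₂ V₃ V₄) {u : ℝ} (hu : 0 < u) :
    uPlus V (V u) = u := by
  have : {w : ℝ | 0 < w ∧ V w = V u} = {u} := by
    refine subset_antisymm (fun w hw => ?_) (by simpa using hu)
    refine h.strictMonoOn_signedRoot.injOn (h.left_neg.trans hw.1) (h.left_neg.trans hu) ?_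
    rw [h.signedRoot_eq_sqrt hw.1, h.signedRoot_eq_sqrt hu, hw.2]
  rw [uPlus, this, csInf_singleton]

theorem uMinus_eq (h : IsSchaafPotential a hstar V V₁ V₂ V₃ V₄) {u : ℝ} (hu : a < u)
    (hu0 : u < 0) : uMinus a V (V u) = u := by
  have : {w : ℝ | a < w ∧ w < 0 ∧ V w = V u} = {u} := by
    refine subset_antisymm (fun w hw => ?_) (by simpa using ⟨hu, hu0⟩)
    refine h.strictMonoOn_signedRoot.injOn hw.1 hu ?_
    rw [h.signedRoot_eq_neg_sqrt hw.1 hw.2.1, h.signedRoot_eq_neg_sqrt hu hu0, hw.2.2]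
  rw [uMinus, this, csSup_singleton]

theorem extendedPeriod_eq (h : IsSchaafPotential a hstar V V₁ V₂ V₃ V₄) {e : ℝ} (he : 0 < e)
    (hex : ∃ u, 0 < u ∧ V u = e) :
    extendedPeriod a hstar V e = √2 * angularTime a V V₁ V₂ √e := by
  obtain ⟨p, hp, rfl⟩ := hex
  have hap : a < p := h.left_neg.trans hp
  have hX := h.strictMonoOn_signedRoot
  have hXp := h.signedRoot_eq_sqrt hp
  rw [← h.setIntegral_eq_angularTime he]
  have hlt : ∀ u, a < u → (V u < V p ↔ -√(V p) < X u ∧ X u < √(V p)) := fun u hu => by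
    rw [← abs_lt, ← h.signedRoot_sq hu, Real.lt_sqrt (abs_nonneg _), sq_abs]
  unfold extendedPeriod
  split_ifs with hlow
  · obtain ⟨m, hm, hmp, hXm⟩ := h.mem_image_signedRoot h.left_neg (x := -√(V p))
      (neg_lt_neg (Real.sqrt_lt_sqrt he.le hlow))
      (by rw [h.signedRoot_zero]; exact neg_nonpos.2 (Real.sqrt_nonneg _))
    have hm0 : m < 0 := lt_of_le_of_ne hmp fun h0 => by
      rw [h0, h.signedRoot_zero] at hXm
      have := Real.sqrt_pos.2 he
      linarith
    have hVm : V m = V p := by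
      rw [← h.signedRoot_sq hm, hXm, neg_sq, Real.sq_sqrt he.le]
    have hset : {u | a < u ∧ V u < V p} = Ioo m p := by
      ext u
      constructor
      · rintro ⟨hu, hup⟩
        rw [hlt u hu, ← hXm, ← hXp] at hup
        exact ⟨(hX.lt_iff_lt hm hu).1 hup.1, (hX.lt_iff_lt hu hap).1 hup.2⟩
      · rintro ⟨h1, h2⟩
        have hu : a < u := hm.trans h1
        refine ⟨hu, (hlt u hu).2 ?_⟩
        rw [← hXm, ← hXp]
        exact ⟨hX hm hu h1, hX hu hap h2⟩
    rw [annulusPeriod, h.uPlus_eq hp, ← hVm, h.uMinus_eq hm hm0, hVm, hset,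
      intervalIntegral.integral_of_le (hm0.trans hp).le,
      MeasureTheory.integral_Ioc_eq_integral_Ioo]
  · have hset : {u | a < u ∧ V u < V p} = Ioo a p := by
      ext u
      refine and_congr_right fun hu => ?_
      rw [hlt u hu, ← hXp, hX.lt_iff_lt hu hap]
      refine and_iff_right_of_imp fun _ => lt_of_le_of_lt ?_ (h.lt_signedRoot hu)
      rw [hXp]
      exact neg_le_neg (Real.sqrt_le_sqrt (not_lt.1 hlow))
    rw [bouncingTime, h.uPlus_eq hp, hset, intervalIntegral.integral_of_le hap.le,
      MeasureTheory.integral_Ioc_eq_integral_Ioo]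

theorem exists_hasDerivAt_extendedPeriod (h : IsSchaafPotential a hstar V V₁ V₂ V₃ V₄) {e : ℝ}
    (he : 0 < e) (hex : ∃ u, 0 < u ∧ V u = e) :
    ∃ T', 0 < T' ∧ HasDerivAt (extendedPeriod a hstar V) T' e := by
  obtain ⟨u, hu, rfl⟩ := hex
  have hau : a < u := h.left_neg.trans hu
  -- an energy level above `e`, so that the profile is controlled on both sides of `√e`
  have hv : 0 < u + 1 := by linarith
  have hav : a < u + 1 := h.left_neg.trans hv
  have hpv : √(V u) < X (u + 1) := by
    rw [← h.signedRoot_eq_sqrt hu]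
    exact h.strictMonoOn_signedRoot hau hav (lt_add_one u)
  have hr : 0 < √(V u) := Real.sqrt_pos.2 he
  have hd := (h.hasDerivAt_angularTime hav hr hpv).2
  have hpos := h.deriv_angularTime_pos hav hr hpv
  have hT := (hd.comp (V u) (Real.hasDerivAt_sqrt he.ne')).const_mul √2
  refine ⟨_, ?_, hT.congr_of_eventuallyEq ?_⟩
  · positivity
  · have hev : ∀ᶠ e in 𝓝 (V u), √e < X (u + 1) :=
      Real.continuous_sqrt.continuousAt.eventually_lt_const hpv
    filter_upwards [hev, Ioi_mem_nhds he] with e hev he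
    have hre : 0 < √e := Real.sqrt_pos.2 he
    obtain ⟨w, hw, -, hwe⟩ := h.mem_image_signedRoot hav
      ((neg_nonpos.2 (Real.sqrt_nonneg hstar)).trans_lt hre) hev.le
    refine h.extendedPeriod_eq he ⟨w, ?_, ?_⟩
    · refine (h.strictMonoOn_signedRoot.lt_iff_lt h.left_neg hw).1 ?_
      rwa [h.signedRoot_zero, hwe]
    · rw [← h.signedRoot_sq hw, hwe, Real.sq_sqrt (le_of_lt he)]

end IsSchaafPotential

theorem mainTheorem5 (a hstar : ℝ) (V : ℝ → ℝ)
    (hV : IsWeaklySingularPotential a hstar V)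
    (hC4 : ContDiffOn ℝ 4 V (Ioi a))
    (hpos : ∀ u, a < u → 0 < iteratedDeriv 2 V u →
      0 < 5 * (iteratedDeriv 3 V u) ^ 2 - 3 * iteratedDeriv 2 V u * iteratedDeriv 4 V u)
    (hzero : ∀ u, a < u → iteratedDeriv 2 V u = 0 → deriv V u * iteratedDeriv 3 V u < 0) :
    ∀ h : ℝ, 0 < h → (∃ u, 0 < u ∧ V u = h) →
      DifferentiableAt ℝ (extendedPeriod a hstar V) h ∧
        0 < deriv (extendedPeriod a hstar V) h := by
  intro h hh hex
  obtain ⟨T, hT, hd⟩ :=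
    (hV.isSchaafPotential hC4 hpos hzero).exists_hasDerivAt_extendedPeriod hh hex
  exact ⟨hd.differentiableAt, by rwa [hd.deriv]⟩
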